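/- A \emph{basic graph} is a finite undirected graph without self-loops; it is regarded as a structure over the vocabulary with one binary relation symbol $\sim$. For a first-order sentence $\phi$ over this vocabulary, the parameterized problem $\text{p-vd}_{\mathrm{basic}}(\phi)$ asks, given (the adjacency matrix, as a binary word, of) a basic graph $G=(V,E)$ with $V\neq\emptyset$ and the parameter $k\in\mathbb N$, whether there is a set $S\subseteq V$ with $|S|\le k$ such that $G\setminus S\models\phi$. The sentence $\phi$ has \emph{pattern $eae$} if $\phi=\exists s\,\forall x\,\exists y\,\psi(s,x,y)$ for a quantifier-free formula $\psi$. The class $\text{para-AC}^0$ consists of the parameterized problems $Q\subseteq\{0,1\}^*\times\mathbb N$ that are decided by a (not necessarily uniform) family $(C_{n,k})_{n,k\in\mathbb N}$ of unbounded fan-in Boolean circuits, where $C_{n,k}$ handles inputs of length $n$ with parameter $k$, of constant depth and of size $f(k)\cdot n^{O(1)}$ for some computable function $f$. Let $G=(V,E)$ be a basic graph and $s\in V$. A \emph{witness} for $x\in V\setminus\{s\}$ relative to $s$ is a vertex $y\in V$ with $G\models\psi(s,x,y)$. For $v\in V\setminus\{s\}$, a \emph{stable $v$-witness walk} of length $j$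 relative to $s$ is a sequence $(v_1,\dots,v_j)$ of vertices with $v_1=v$ such that $v_{i+1}$ is a witness for $v_i\neq s$ for all $i<j$, the vertices $v_1,\dots,v_{j-1}$ are distinct, and $v_j=s$ or $v_j=v_i$ for some $i<j$. Call $S\subseteq V\setminus\{s\}$ a \emph{solution for $s$} if $G\setminus S\models\forall x\,\exists y\,\psi(s,x,y)$. \textbf{Lemma.} Let $\phi=\exists s\,\forall x\,\exists y\,\psi$ be any sentence with pattern $eae$. Then $\text{p-vd}_{\mathrm{basic}}(\phi)\in\text{para-AC}^0$. Moreover, for every basic graph $G=(V,E)$, every $s\in V$ and every $v\in V\setminus\{s\}$: (1) if there is a solution for $s$ at all, then $v$ belongs to every solution for $s$ if and only if there is no stable $v$-witness walk relative to $s$; (2) if there is a stable $v$-witness walk relative to $s$, then there is one of length at most $10$. -/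

import Mathlib

/-! ### Unbounded fan-in Boolean circuits and the class para-AC⁰ -/

/-- A gate of a Boolean circuit with `n` input bits, whose predecessors are among `m` gates.
Conjunctions and disjunctions have unbounded fan-in (the empty ones are the Boolean constants). -/
inductive Gate (n m : ℕ) : Type
  | input (i : Fin n) : Gate n m
  | not (g : Fin m) : Gate n m
  | and (gs : Finset (Fin m)) : Gate n m
  | or (gs : Finset (Fin m)) : Gate n m

/-- A Boolean circuit (a directed acyclic graph of gates) with `n` input bits and one output gate.
The gates are listed in topological order: gate `i` only reads gates with a smaller index.
Its size is the number of its gates. -/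
structure Circuit (n : ℕ) : Type where
  size : ℕ
  gate : (i : Fin size) → Gate n i
  output : Fin size

namespace Circuit

variable {n : ℕ}

/-- The value of gate `i` on the input `x`. -/
def val (C : Circuit n) (x : Fin n → Bool) (i : Fin C.size) : Bool :=
  match C.gate i with
  | .input j => x j
  | .not g => !C.val x ⟨g, g.2.trans i.2⟩
  | .and gs => decide (∀ g ∈ gs, C.val x ⟨g, g.2.trans i.2⟩ = true)
  | .or gs => decide (∃ g ∈ gs, C.val x ⟨g, g.2.trans i.2⟩ = true)
termination_by i.val

/-- The length of a longest path from an input or constant to gate `i`. -/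
def gateDepth (C : Circuit n) (i : Fin C.size) : ℕ :=
  match C.gate i with
  | .input _ => 0
  | .not g => C.gateDepth ⟨g, g.2.trans i.2⟩ + 1
  | .and gs => gs.sup fun g => C.gateDepth ⟨g, g.2.trans i.2⟩ + 1
  | .or gs => gs.sup fun g => C.gateDepth ⟨g, g.2.trans i.2⟩ + 1
termination_by i.val

/-- The output bit of the circuit on the input `x`. -/
def eval (C : Circuit n) (x : Fin n → Bool) : Bool := C.val x C.output

/-- The depth of the circuit. -/
def depth (C : Circuit n) : ℕ := C.gateDepth C.output

end Circuit

/-- A parameterized problem over the binary alphabet: a set of pairs (input word, parameter). -/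
abbrev ParamProblem : Type := Set (List Bool × ℕ)

/-- The class para-AC⁰ of the parameterized problems that are decided by a family
`(C n k)` of unbounded fan-in circuits of constant depth and size `f(k) · n^{O(1)}` for a
computable `f`.  (The bound is written with `n + 1` only to be meaningful for `n = 0`.) -/
def ParaAC0 : Set ParamProblem :=
  {Q | ∃ (C : (n k : ℕ) → Circuit n) (d c : ℕ) (f : ℕ → ℕ), Computable f ∧
    (∀ n k, (C n k).depth ≤ d ∧ (C n k).size ≤ f k * (n + 1) ^ c) ∧
    ∀ (n k : ℕ) (x : Fin n → Bool), (C n k).eval x = true ↔ (List.ofFn x, k) ∈ Q}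

/-! ### Quantifier patterns -/

/-- The letters `a` (universal) and `e` (existential) of quantifier patterns. -/
inductive Quantifier : Type
  | a : Quantifier
  | e : Quantifier

/-- `HasPattern φ p`: the formula `φ` consists of quantifiers forming the pattern `p`, followed by
a quantifier-free formula. -/
inductive HasPattern {L : FirstOrder.Language.{0, 0}} :
    {n : ℕ} → L.BoundedFormula Empty n → List Quantifier → Prop
  | qf {n : ℕ} {φ : L.BoundedFormula Empty n} (h : φ.IsQF) : HasPattern φ []
  | all {n : ℕ} {φ : L.BoundedFormula Empty (n + 1)} {p : List Quantifier}
      (h : HasPattern φ p) : HasPattern φ.all (Quantifier.a :: p)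
  | ex {n : ℕ} {φ : L.BoundedFormula Empty (n + 1)} {p : List Quantifier}
      (h : HasPattern φ p) : HasPattern φ.ex (Quantifier.e :: p)

/-! ### Vertex deletion on basic graphs -/

/-- `G ⊨ φ[xs]`, where a simple graph is viewed as a structure over the vocabulary with one binary
relation symbol, and the free variables of `φ` are interpreted by `xs`. -/
def GraphRealize {V : Type*} (G : SimpleGraph V) {n : ℕ}
    (φ : FirstOrder.Language.graph.BoundedFormula Empty n) (xs : Fin n → V) : Prop :=
  letI := G.structure
  φ.Realize Empty.elim xs

/-- The graph `G ∖ S`. -/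
abbrev deleteVertices {V : Type*} (G : SimpleGraph V) (S : Finset V) :
    SimpleGraph {v : V // v ∉ S} :=
  G.induce {v : V | v ∉ S}

open Classical in
/-- The encoding of a graph with vertex set `{0, …, n - 1}` as a word: the rows of its adjacency
matrix, one after the other. -/
noncomputable def encodeGraph {n : ℕ} (G : SimpleGraph (Fin n)) : List Bool :=
  List.ofFn fun i : Fin (n * n) => decide (G.Adj i.divNat i.modNat)

/-- The problem p-vertex-deletion on basic graphs for the sentence `φ`: given (the encoding of) a
basic graph `G` with a nonempty vertex set and the parameter `k`, is there a set `S` of at most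
`k` vertices such that `G ∖ S` is a model of `φ`? -/
def vdBasic (φ : FirstOrder.Language.graph.Sentence) : ParamProblem :=
  {I | ∃ (n : ℕ) (G : SimpleGraph (Fin n)), 0 < n ∧ I.1 = encodeGraph G ∧
    ∃ S : Finset (Fin n), S.card ≤ I.2 ∧ GraphRealize (deleteVertices G S) φ ![]}

/-- The class of all problems p-vertex-deletion on basic graphs for sentences with pattern `p`. -/
def VDBasic (p : List Quantifier) : Set ParamProblem :=
  {Q | ∃ φ : FirstOrder.Language.graph.Sentence, HasPattern φ p ∧ Q = vdBasic φ}

/-! ### Witness walks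

Here `ψ(s, x, y)` is the quantifier-free part of a sentence `∃ s ∀ x ∃ y ψ(s, x, y)`. -/

section WitnessWalks

variable {V : Type*} (G : SimpleGraph V)
  (ψ : FirstOrder.Language.graph.BoundedFormula Empty 3) (s : V)

/-- `y` is a witness, relative to `s`, for the vertex `x ≠ s`. -/
def IsWitness (x y : V) : Prop := x ≠ s ∧ GraphRealize G ψ ![s, x, y]

/-- `w = (v₁, …, vⱼ)` is a stable `v`-witness walk relative to `s`: it starts at `v`, every next
vertex is a witness for the one before, `v₁, …, vⱼ₋₁` are distinct, and the last vertex `vⱼ` is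
`s` (the walk is `s`-terminated) or one of `v₁, …, vⱼ₋₁` (the walk is returning). -/
def IsStableWalk (v : V) (w : List V) : Prop :=
  w.head? = some v ∧ w.IsChain (IsWitness G ψ s) ∧ w.dropLast.Nodup ∧
    ∃ t, w.getLast? = some t ∧ (t = s ∨ t ∈ w.dropLast)

/-- Deleting `S`, which does not contain `s`, makes `∀ x ∃ y ψ(s, x, y)` true. -/
def IsSolution (S : Finset V) : Prop :=
  ∃ hs : s ∉ S, GraphRealize (deleteVertices G S) ψ.ex.all ![⟨s, hs⟩]

end WitnessWalks

/-! Fix `s`. Following witnesses from a vertex that survives a solution, until `s` or a repetition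
is met, traces a stable walk. Conversely, the vertices of a stable walk can be kept together,
because each of them other than `s` has a witness on the walk. So the complement of every solution
lies in `keptVertices`, and deleting exactly the other vertices is a solution as soon as `s` itself
has a witness among the kept ones. This is `exists_isSolution_card_le_iff`; part (1) of the theorem
comes from the same two observations.

Short walks suffice (`exists_isStableWalk_length_le`). Colour a vertex by its adjacency to `s`. For
distinct `x, y ≠ s`, whether `y` is a witness for `x` depends only on the two colours and on the
adjacency of `x` and `y`. Between equal colours the relation is therefore symmetric, and a step can
be walked back. If the first steps of a long walk alternate colours, then either the first one can
be reversed or any two vertices of different colours are related in some direction. The latter lets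
the walk be closed early or shortened by two vertices.

Hence a circuit of constant depth and polynomial size finds the kept vertices by trying all walks of
length at most 10. The parameter enters only through the test that at most `k` vertices are not
kept. Hashing modulo a prime performs it in constant depth at the cost of a factor depending on `k`
(`Computes.ncard_le`). A disjunction over `s` and a check that the word is an adjacency matrix
complete the circuit. -/

open FirstOrder FirstOrder.Language in
/-- Quantifier-free formulas in the language of graphs are built from equalities and adjacencies
between variables. -/
theorem graphQF_induction {n : ℕ} {P : Language.graph.BoundedFormula Empty n → Prop}
    (falsum : P .falsum)
    (eq : ∀ i j : Fin n, P ((Term.var (Sum.inr i)).bdEqual (Term.var (Sum.inr j))))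
    (adj : ∀ i j : Fin n, P (Relations.boundedFormula₂ Language.adj
      (Term.var (Sum.inr i)) (Term.var (Sum.inr j))))
    (imp : ∀ φ χ, P φ → P χ → P (φ.imp χ))
    {φ : Language.graph.BoundedFormula Empty n} (h : φ.IsQF) : P φ := by
  have term : ∀ t : Language.graph.Term (Empty ⊕ Fin n), ∃ i, t = Term.var (Sum.inr i)
    | .var (.inr i) => ⟨i, rfl⟩
    | .func f _ => isEmptyElim f
  induction h with
  | falsum => exact falsum
  | of_isAtomic h =>
    cases h with
    | equal t₁ t₂ =>
      obtain ⟨i, rfl⟩ := term t₁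
      obtain ⟨j, rfl⟩ := term t₂
      exact eq i j
    | rel R ts =>
      cases R
      obtain ⟨i, hi⟩ := term (ts 0)
      obtain ⟨j, hj⟩ := term (ts 1)
      have : ts = ![Term.var (Sum.inr i), Term.var (Sum.inr j)] := by
        ext k
        fin_cases k
        · simpa using hi
        · simpa using hj
      rw [this]
      exact adj i j
  | imp _ _ h₁ h₂ => exact imp _ _ h₁ h₂

/-! ### Semantics of formulas in graphs and induced subgraphs. -/

section GraphRealize

variable {V V' : Type*} (G : SimpleGraph V) (G' : SimpleGraph V') {n : ℕ}

open FirstOrder FirstOrder.Language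

theorem graphRealize_falsum (xs : Fin n → V) : ¬ GraphRealize G .falsum xs := id

theorem graphRealize_imp (φ χ : Language.graph.BoundedFormula Empty n) (xs : Fin n → V) :
    GraphRealize G (φ.imp χ) xs ↔ (GraphRealize G φ xs → GraphRealize G χ xs) :=
  Iff.rfl

theorem graphRealize_ex (φ : Language.graph.BoundedFormula Empty (n + 1)) (xs : Fin n → V) :
    GraphRealize G φ.ex xs ↔ ∃ a, GraphRealize G φ (Fin.snoc xs a) := by
  let := G.structure
  exact BoundedFormula.realize_ex

theorem graphRealize_all (φ : Language.graph.BoundedFormula Empty (n + 1)) (xs : Fin n → V) :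
    GraphRealize G φ.all xs ↔ ∀ a, GraphRealize G φ (Fin.snoc xs a) :=
  Iff.rfl

variable {G G'}

/-- The truth of a quantifier-free formula depends only on the equalities and adjacencies between
the values of the variables. -/
theorem graphRealize_congr {φ : Language.graph.BoundedFormula Empty n} (hφ : φ.IsQF)
    {xs : Fin n → V} {ys : Fin n → V'} (heq : ∀ i j, xs i = xs j ↔ ys i = ys j)
    (hadj : ∀ i j, G.Adj (xs i) (xs j) ↔ G'.Adj (ys i) (ys j)) :
    GraphRealize G φ xs ↔ GraphRealize G' φ ys := by
  refine graphQF_induction (P := fun φ => GraphRealize G φ xs ↔ GraphRealize G' φ ys)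
    (iff_of_false (graphRealize_falsum G xs) (graphRealize_falsum G' ys)) heq hadj ?_ hφ
  intro φ χ h₁ h₂
  rw [graphRealize_imp, graphRealize_imp, h₁, h₂]

theorem graphRealize_deleteVertices {φ : Language.graph.BoundedFormula Empty n} (hφ : φ.IsQF)
    (S : Finset V) (xs : Fin n → {v // v ∉ S}) :
    GraphRealize (deleteVertices G S) φ xs ↔ GraphRealize G φ fun i => (xs i : V) :=
  graphRealize_congr hφ (fun _ _ => Subtype.ext_iff) fun _ _ => Iff.rfl

/-- Quantifier-free truth passes between a graph and its induced subgraphs, so deleting `S` only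
restricts the ranges of `x` and `y`. -/
theorem isSolution_iff {ψ : Language.graph.BoundedFormula Empty 3} (hψ : ψ.IsQF) {s : V}
    {S : Finset V} :
    IsSolution G ψ s S ↔ s ∉ S ∧ ∀ x ∉ S, ∃ y ∉ S, GraphRealize G ψ ![s, x, y] := by
  have key : ∀ (x y : {v // v ∉ S}) (hs : s ∉ S),
      GraphRealize (deleteVertices G S) ψ (Fin.snoc (Fin.snoc ![⟨s, hs⟩] x) y) ↔
        GraphRealize G ψ ![s, x, y] := by
    intro x y hs
    rw [graphRealize_deleteVertices hψ]
    refine iff_of_eq (congrArg _ (funext fun i => ?_))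
    fin_cases i <;> rfl
  constructor
  · rintro ⟨hs, h⟩
    refine ⟨hs, fun x hx => ?_⟩
    obtain ⟨y, hy⟩ := (graphRealize_ex _ _ _).1 ((graphRealize_all _ _ _).1 h ⟨x, hx⟩)
    exact ⟨y, y.2, (key ⟨x, hx⟩ y hs).1 hy⟩
  · rintro ⟨hs, h⟩
    refine ⟨hs, (graphRealize_all _ _ _).2 fun x => (graphRealize_ex _ _ _).2 ?_⟩
    obtain ⟨y, hy, hxy⟩ := h x x.2
    exact ⟨⟨y, hy⟩, (key x ⟨y, hy⟩ hs).2 hxy⟩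

theorem graphRealize_eae_iff {ψ : Language.graph.BoundedFormula Empty 3} (S : Finset V) :
    GraphRealize (deleteVertices G S) ψ.ex.all.ex ![] ↔ ∃ s, IsSolution G ψ s S := by
  rw [graphRealize_ex]
  have : ∀ a : {v // v ∉ S}, (Fin.snoc ![] a : Fin 1 → {v // v ∉ S}) = ![a] := by
    intro a
    ext i
    fin_cases i
    rfl
  constructor
  · rintro ⟨a, ha⟩
    exact ⟨a, a.2, this a ▸ ha⟩
  · rintro ⟨s, hs, h⟩
    exact ⟨⟨s, hs⟩, (this ⟨s, hs⟩).symm ▸ h⟩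

end GraphRealize

/-! ### Stable walks and the least solution for `s`. -/

section StableWalks

variable {V : Type*} {G : SimpleGraph V} {ψ : FirstOrder.Language.graph.BoundedFormula Empty 3}
  {s v : V}

theorem IsStableWalk.mem {w : List V} (hw : IsStableWalk G ψ s v w) : v ∈ w :=
  List.mem_of_mem_head? hw.1

/-- A vertex before the end has its successor as a witness. The last vertex, if it is not `s`, also
occurs earlier and has a successor there. -/
theorem IsStableWalk.exists_isWitness {w : List V} (hw : IsStableWalk G ψ s v w) {x : V}
    (hx : x ∈ w) (hxs : x ≠ s) : ∃ y ∈ w, IsWitness G ψ s x y := by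
  obtain ⟨-, hchain, -, t, ht, hts⟩ := hw
  have hx' : x ∈ w.dropLast := by
    have hne : w ≠ [] := List.ne_nil_of_mem hx
    rw [← List.dropLast_append_getLast hne] at hx
    rw [List.getLast?_eq_some_getLast hne, Option.some_inj] at ht
    simp only [List.mem_append, List.mem_singleton, ht] at hx
    rcases hx with hx | rfl
    · exact hx
    · exact hts.resolve_left hxs
  obtain ⟨i, hi, rfl⟩ := List.getElem_of_mem hx'
  have hi' : i + 1 < w.length := by
    rw [List.length_dropLast] at hi
    omega
  rw [List.getElem_dropLast]
  exact ⟨w[i + 1], List.getElem_mem _, List.isChain_iff_getElem.1 hchain i hi'⟩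

/-- Every vertex of a set in which all vertices other than `s` have witnesses starts a stable
walk. -/
theorem exists_isStableWalk_of_closed [Finite V] {A : Set V}
    (hA : ∀ x ∈ A, x ≠ s → ∃ y ∈ A, IsWitness G ψ s x y) (hv : v ∈ A) :
    ∃ w, IsStableWalk G ψ s v w := by
  classical
  choose! f hfA hf using hA
  set u : ℕ → V := fun i => f^[i] v with hu
  -- Finiteness makes the orbit repeat. Cutting it at the first time it meets `s` or an earlier
  -- value leaves distinct values other than `s` before the cut, and `f` is applied only where its
  -- choice is meaningful.
  have hterm : ∃ j, u j = s ∨ ∃ i < j, u i = u j := by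
    obtain ⟨i, j, hij, h⟩ := Finite.exists_ne_map_eq_of_infinite u
    rcases lt_or_gt_of_ne hij with hlt | hlt
    · exact ⟨j, Or.inr ⟨i, hlt, h⟩⟩
    · exact ⟨i, Or.inr ⟨j, hlt, h.symm⟩⟩
  set j := Nat.find hterm with hj
  have hmin : ∀ i < j, u i ≠ s ∧ ∀ i' < i, u i' ≠ u i := by
    intro i hi
    have := Nat.find_min hterm hi
    push Not at this
    exact this
  have hsucc : ∀ i, u (i + 1) = f (u i) := fun i => Function.iterate_succ_apply' f i v
  have huA : ∀ i ≤ j, u i ∈ A := by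
    intro i
    induction i with
    | zero => exact fun _ => hv
    | succ i ih =>
      intro hi
      rw [hsucc]
      exact hfA _ (ih (by omega)) (hmin i (by omega)).1
  have hdrop : ((List.range (j + 1)).map u).dropLast = (List.range j).map u := by
    rw [List.range_succ, List.map_append, List.map_singleton, List.dropLast_concat]
  refine ⟨(List.range (j + 1)).map u, ?_, ?_, ?_, u j, ?_, ?_⟩
  · simp [List.range_succ_eq_map, hu]
  · rw [List.isChain_iff_getElem]
    intro i hi
    simp only [List.length_map, List.length_range] at hi
    simp only [List.getElem_map, List.getElem_range]
    rw [hsucc]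
    exact hf _ (huA i (by omega)) (hmin i (by omega)).1
  · rw [hdrop]
    refine List.Nodup.map_on ?_ List.nodup_range
    intro a ha b hb hab
    rw [List.mem_range] at ha hb
    by_contra hne
    rcases lt_or_gt_of_ne hne with hlt | hlt
    · exact (hmin b hb).2 a hlt hab
    · exact (hmin a ha).2 b hlt hab.symm
  · rw [List.range_succ, List.map_append, List.map_singleton, List.getLast?_concat]
  · rw [hdrop]
    rcases Nat.find_spec hterm with h | ⟨i, hi, h⟩
    · exact Or.inl h
    · exact Or.inr (List.mem_map.2 ⟨i, List.mem_range.2 hi, h⟩)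

/-- The vertices that can be kept: `s` and the vertices with a stable walk. -/
def keptVertices (G : SimpleGraph V) (ψ : FirstOrder.Language.graph.BoundedFormula Empty 3)
    (s : V) : Set V :=
  {v | v = s ∨ ∃ w, IsStableWalk G ψ s v w}

/-- The tail of the walk starting at `x` need not be stable, since the walk may return to a vertex
before `x`. A new walk is built inside the vertex set instead. -/
theorem IsStableWalk.mem_keptVertices [Finite V] {w : List V} (hw : IsStableWalk G ψ s v w) {x : V}
    (hx : x ∈ w) : x ∈ keptVertices G ψ s := by
  by_cases hxs : x = s
  · exact Or.inl hxs
  · exact Or.inr (exists_isStableWalk_of_closed (A := {y | y ∈ w})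
      (fun _ hy hys => hw.exists_isWitness hy hys) hx)

theorem IsSolution.mem_keptVertices [Finite V] (hψ : ψ.IsQF) {S : Finset V}
    (hS : IsSolution G ψ s S) {x : V} (hx : x ∉ S) : x ∈ keptVertices G ψ s := by
  rw [isSolution_iff hψ] at hS
  by_cases hxs : x = s
  · exact Or.inl hxs
  · refine Or.inr (exists_isStableWalk_of_closed (A := {y | y ∉ S}) (fun y hy hys => ?_) hx)
    obtain ⟨z, hz, hyz⟩ := hS.2 y hy
    exact ⟨z, hz, hys, hyz⟩

theorem exists_isWitness_keptVertices [Finite V] {x : V} (hx : x ∈ keptVertices G ψ s)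
    (hxs : x ≠ s) : ∃ y ∈ keptVertices G ψ s, GraphRealize G ψ ![s, x, y] := by
  obtain ⟨w, hw⟩ := hx.resolve_left hxs
  obtain ⟨y, hy, hxy⟩ := hw.exists_isWitness hw.mem hxs
  exact ⟨y, hw.mem_keptVertices hy, hxy.2⟩

/-- There is a solution for `s` with at most `k` vertices iff `s` has a witness among the kept
vertices and there are at most `k` others. -/
theorem exists_isSolution_card_le_iff [Fintype V] (hψ : ψ.IsQF) (k : ℕ) :
    (∃ S : Finset V, S.card ≤ k ∧ IsSolution G ψ s S) ↔
      (∃ y ∈ keptVertices G ψ s, GraphRealize G ψ ![s, s, y]) ∧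
        (keptVertices G ψ s)ᶜ.ncard ≤ k := by
  classical
  constructor
  · rintro ⟨S, hk, hS⟩
    constructor
    · obtain ⟨y, hy, h⟩ := ((isSolution_iff hψ).1 hS).2 s ((isSolution_iff hψ).1 hS).1
      exact ⟨y, hS.mem_keptVertices hψ hy, h⟩
    · refine le_trans ?_ hk
      rw [← Set.ncard_coe_finset]
      refine Set.ncard_le_ncard (fun x hx => ?_) S.finite_toSet
      by_contra hxS
      exact hx (hS.mem_keptVertices hψ hxS)
  · rintro ⟨⟨y, hy, hsy⟩, hk⟩
    -- Walks say nothing about a witness for `s` itself; that one is supplied by `y`.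
    refine ⟨(keptVertices G ψ s)ᶜ.toFinset, ?_, (isSolution_iff hψ).2 ⟨?_, fun x hx => ?_⟩⟩
    · rwa [← Set.ncard_eq_toFinset_card']
    · exact fun h => Set.mem_toFinset.1 h (Or.inl rfl)
    · simp only [Set.mem_toFinset, Set.mem_compl_iff, not_not] at hx ⊢
      by_cases hxs : x = s
      · exact ⟨y, hy, hxs ▸ hsy⟩
      · exact exists_isWitness_keptVertices hx hxs

/-- Putting the vertices of a stable walk back into a solved graph preserves the solution.
Conversely, the complement of a solution is closed under some choice of witnesses, so its vertices
other than `s` start stable walks. -/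
theorem forall_isSolution_mem_iff [Finite V] (hψ : ψ.IsQF) (hvs : v ≠ s)
    (h : ∃ S : Finset V, IsSolution G ψ s S) :
    (∀ S : Finset V, IsSolution G ψ s S → v ∈ S) ↔ ¬ ∃ w, IsStableWalk G ψ s v w := by
  classical
  constructor
  · rintro hall ⟨w, hw⟩
    obtain ⟨S, hS⟩ := h
    obtain ⟨hs, hT⟩ := (isSolution_iff hψ).1 hS
    refine (Finset.mem_sdiff.1 (hall (S \ w.toFinset) ((isSolution_iff hψ).2 ⟨?_, ?_⟩))).2
      (by simpa using hw.mem)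
    · simp [hs]
    · intro x hx
      simp only [Finset.mem_sdiff, List.mem_toFinset, not_and, not_not] at hx ⊢
      by_cases hxS : x ∈ S
      · have hxs : x ≠ s := fun h => hs (h ▸ hxS)
        obtain ⟨y, hy, hxy⟩ := hw.exists_isWitness (hx hxS) hxs
        exact ⟨y, fun _ => hy, hxy.2⟩
      · obtain ⟨y, hy, hxy⟩ := hT x hxS
        exact ⟨y, fun h => absurd h hy, hxy⟩
  · intro hno S hS
    by_contra hvS
    exact ((hS.mem_keptVertices hψ hvS).resolve_left hvs).elim fun w hw => hno ⟨w, hw⟩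

end StableWalks

/-! ### Shortening stable walks. -/

section ShortWalks

variable {V : Type*} {G : SimpleGraph V} {ψ : FirstOrder.Language.graph.BoundedFormula Empty 3}
  {s v : V}

/-- Being a witness depends only on the adjacencies to `s` and to each other. -/
theorem IsWitness.congr (hψ : ψ.IsQF) {x y x' y' : V} (h : IsWitness G ψ s x y)
    (hys : y ≠ s) (hxs' : x' ≠ s) (hys' : y' ≠ s) (hxy : x ≠ y) (hxy' : x' ≠ y')
    (hx : G.Adj s x ↔ G.Adj s x') (hy : G.Adj s y ↔ G.Adj s y')
    (hadj : G.Adj x y ↔ G.Adj x' y') : IsWitness G ψ s x' y' := by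
  refine ⟨hxs', (graphRealize_congr hψ (fun i j => ?_) fun i j => ?_).1 h.2⟩
  · have := h.1
    fin_cases i <;> fin_cases j <;> simp_all [eq_comm]
  · fin_cases i <;> fin_cases j <;> simp_all [G.adj_comm]

theorem IsWitness.symm (hψ : ψ.IsQF) {x y : V} (h : IsWitness G ψ s x y) (hys : y ≠ s)
    (hxy : x ≠ y) (hc : G.Adj s x ↔ G.Adj s y) : IsWitness G ψ s y x :=
  h.congr hψ hys hys h.1 hxy hxy.symm hc hc.symm (G.adj_comm _ _)

/-- If two consecutive steps of a walk lead from one side of the neighbourhood of `s` to the other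
and back, then either the first step can be reversed or any two vertices on different sides are
related by being a witness, in one direction or the other. -/
theorem IsWitness.symm_or_total (hψ : ψ.IsQF) {a b c : V} (hab : IsWitness G ψ s a b)
    (hbc : IsWitness G ψ s b c) (hcs : c ≠ s) (hcab : ¬(G.Adj s a ↔ G.Adj s b))
    (hcbc : ¬(G.Adj s b ↔ G.Adj s c)) :
    IsWitness G ψ s b a ∨ ∀ x y, x ≠ s → y ≠ s → ¬(G.Adj s x ↔ G.Adj s y) →
      ¬IsWitness G ψ s x y → IsWitness G ψ s y x := by
  have hne : ∀ {x y}, ¬(G.Adj s x ↔ G.Adj s y) → x ≠ y := fun h hxy => h (hxy ▸ Iff.rfl)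
  refine or_iff_not_imp_left.2 fun hba => ?_
  -- Otherwise `(b, c)` and `(b, a)` would agree in colours and adjacency, and `a` would be a
  -- witness for `b`.
  have hadj : G.Adj b c ↔ ¬G.Adj a b := by
    by_contra h
    refine hba (hbc.congr hψ hcs hbc.1 hab.1 (hne hcbc) (hne hcab).symm Iff.rfl (by grind) ?_)
    rw [G.adj_comm b a]
    grind
  -- The steps `a → b` and `b → c` go in opposite directions between the colours and realise both
  -- adjacency values, so every pair of different colours copies one of them.
  have key : ∀ x y, x ≠ s → y ≠ s → (G.Adj s a ↔ G.Adj s x) → (G.Adj s b ↔ G.Adj s y) →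
      IsWitness G ψ s x y ∨ IsWitness G ψ s y x := by
    intro x y hxs hys hax hby
    have hxy : x ≠ y := hne (by grind)
    by_cases h : G.Adj a b ↔ G.Adj x y
    · exact Or.inl (hab.congr hψ hbc.1 hxs hys (hne hcab) hxy hax hby h)
    · refine Or.inr (hbc.congr hψ hcs hys hxs (hne hcbc) hxy.symm hby (by grind) ?_)
      rw [G.adj_comm y x]
      grind
  intro x y hxs hys hxy hnot
  by_cases hax : G.Adj s a ↔ G.Adj s x
  · exact (key x y hxs hys hax (by grind)).resolve_left hnot
  · exact (key y x hys hxs (by grind) (by grind)).resolve_right hnot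

theorem not_iff_of_not_iff_of_not_iff {p q r t : Prop} (h₁ : ¬(p ↔ q)) (h₂ : ¬(q ↔ r))
    (h₃ : ¬(r ↔ t)) : ¬(p ↔ t) := by
  tauto

theorem exists_isStableWalk_length_le (hψ : ψ.IsQF) {w : List V} (hw : IsStableWalk G ψ s v w) :
    ∃ w, IsStableWalk G ψ s v w ∧ w.length ≤ 10 := by
  induction hn : w.length using Nat.strong_induction_on generalizing w with
  | _ n ih =>
  subst hn
  by_cases hlen : w.length ≤ 10
  · exact ⟨w, hw, hlen⟩
  -- Only the first five vertices, the last one `t` and its predecessor `p` matter.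
  obtain ⟨a, b, c, d, e, r, p, t, rfl⟩ : ∃ a b c d e r p t,
      w = (a :: b :: c :: d :: e :: (r ++ [p])) ++ [t] := by
    clear hw ih
    obtain _ | ⟨a, _ | ⟨b, _ | ⟨c, _ | ⟨d, _ | ⟨e, q⟩⟩⟩⟩⟩ := w
    iterate 5 simp at hlen
    rcases List.eq_nil_or_concat' q with rfl | ⟨q, t, rfl⟩
    · simp at hlen
    rcases List.eq_nil_or_concat' q with rfl | ⟨r, p, rfl⟩
    · simp at hlen
    exact ⟨a, b, c, d, e, r, p, t, rfl⟩
  obtain ⟨hhead, hchain, hnodup, t', ht', hts⟩ := hw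
  rw [List.getLast?_concat, Option.some_inj] at ht'
  subst ht'
  rw [List.dropLast_concat] at hnodup hts
  obtain rfl : a = v := by simpa using hhead
  rw [List.isChain_append] at hchain
  obtain ⟨hchain, -, hlast⟩ := hchain
  have hpt : IsWitness G ψ s p t :=
    hlast p (List.getLast?_concat (l := a :: b :: c :: d :: e :: r)) t rfl
  simp only [List.isChain_cons_cons] at hchain
  obtain ⟨hab, hbc, hcd, hde, hep⟩ := hchain
  have hes : e ≠ s := by
    rcases r with _ | ⟨f, r⟩
    · simp at hep
      exact hep.1
    · simp at hep
      exact hep.1.1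
  clear hlast
  have hnd : [a, b, c, d, e, p].Nodup := hnodup.sublist (by simp)
  have ne_of {x y : V} (h : [x, y].Sublist [a, b, c, d, e, p]) : x ≠ y := by
    simpa using hnd.sublist h
  -- The walks closed in this way below have at most seven vertices, so the bound 10 has slack.
  have short : ∀ l x, (l ++ [x]).head? = some a → (l ++ [x]).IsChain (IsWitness G ψ s) → l.Nodup →
      x ∈ l → l.length ≤ 9 → ∃ w, IsStableWalk G ψ s a w ∧ w.length ≤ 10 := by
    intro l x h₁ h₂ h₃ h₄ h₅
    refine ⟨l ++ [x], ⟨h₁, h₂, ?_, x, ?_, ?_⟩, ?_⟩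
    · rwa [List.dropLast_concat]
    · rw [List.getLast?_concat]
    · rw [List.dropLast_concat]
      exact Or.inr h₄
    · simpa [Nat.lt_succ_iff] using h₅
  by_cases cab : G.Adj s a ↔ G.Adj s b
  · exact short [a, b] a rfl (by simp [hab, hab.symm hψ hbc.1 (ne_of (by simp)) cab]) (hnd.sublist (by simp))
      (by simp)
      (by simp)
  by_cases cbc : G.Adj s b ↔ G.Adj s c
  · exact short [a, b, c] b rfl (by simp [hab, hbc, hbc.symm hψ hcd.1 (ne_of (by simp)) cbc]) (hnd.sublist (by simp))
      (by simp) (by simp)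
  by_cases ccd : G.Adj s c ↔ G.Adj s d
  · exact short [a, b, c, d] c rfl (by simp [hab, hbc, hcd, hcd.symm hψ hde.1 (ne_of (by simp)) ccd])
      (hnd.sublist (by simp)) (by simp) (by simp)
  by_cases cde : G.Adj s d ↔ G.Adj s e
  · exact short [a, b, c, d, e] d rfl (by simp [hab, hbc, hcd, hde, hde.symm hψ hes
      (ne_of (List.IsInfix.sublist ⟨[a, b, c], [p], rfl⟩)) cde])
      (hnd.sublist (by simp)) (by simp) (by simp)
  rcases hab.symm_or_total hψ hbc hcd.1 cab cbc with hba | total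
  · exact short [a, b] a rfl (by simp [hab, hba]) (hnd.sublist (by simp)) (by simp) (by simp)
  -- After three colour changes `a` and `d` have different colours, so one is a witness for the
  -- other. If only `d → a` holds, the walk closes at `a`.
  by_cases had : IsWitness G ψ s a d
  swap
  · exact short [a, b, c, d] a rfl
      (by simp [hab, hbc, hcd, total a d hab.1 hde.1 (not_iff_of_not_iff_of_not_iff cab cbc ccd) had])
      (hnd.sublist (by simp))
      (by simp)
      (by simp)
  -- Since `a → d`, the vertices `b` and `c` can be skipped. The result is stable provided that the
  -- endpoint `x` is `s` or still on the walk, and induction applies to it.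
  have cut : ∀ x, IsWitness G ψ s p x → (x = s ∨ x ∈ a :: d :: e :: (r ++ [p])) →
      ∃ w, IsStableWalk G ψ s a w ∧ w.length ≤ 10 := by
    intro x hpx hx
    refine ih _ ?_ (w := (a :: d :: e :: (r ++ [p])) ++ [x]) ⟨rfl, ?_, ?_, x, ?_, ?_⟩ rfl
    · simp
    · rw [List.isChain_append]
      refine ⟨?_, List.isChain_singleton x, ?_⟩
      · simp only [List.isChain_cons_cons]
        exact ⟨had, hde, hep⟩
      · intro y hy z hz
        obtain rfl : p = y := Option.some_inj.1
          ((List.getLast?_concat (l := a :: d :: e :: r)).symm.trans hy)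
        obtain rfl : x = z := by simpa using hz
        exact hpx
    · rw [List.dropLast_concat]
      exact hnodup.sublist (((List.Sublist.refl _).cons c |>.cons b).cons_cons a)
    · rw [List.getLast?_concat]
    · rwa [List.dropLast_concat]
  -- Skipping fails only if the walk returned to `b` or `c`. Then `t` is replaced by the vertex two
  -- steps further, which has the same colour: either `p` steps to it and the cut works, or it steps
  -- to `p` and closes a short walk through `p` back to `t`.
  by_cases htb : t = b
  · subst htb
    by_cases cpb : G.Adj s p ↔ G.Adj s t
    · exact short [a, t, p] t rfl (by simp [hab, hpt, hpt.symm hψ hbc.1 (ne_of (by simp)).symm cpb])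
        (hnd.sublist (by simp)) (by simp) (by simp)
    by_cases hpd : IsWitness G ψ s p d
    · exact cut d hpd (by simp)
    · exact short [a, t, c, d, p] t rfl
        (by simp [hab, hbc, hcd, total p d hpt.1 hde.1
          (not_iff_of_not_iff_of_not_iff cpb cbc ccd) hpd, hpt])
        (hnd.sublist (by simp)) (by simp) (by simp)
  by_cases htc : t = c
  · subst htc
    by_cases cpc : G.Adj s p ↔ G.Adj s t
    · exact short [a, b, t, p] t rfl (by simp [hab, hbc, hpt, hpt.symm hψ hcd.1 (ne_of (by simp)).symm cpc])
        (hnd.sublist (by simp)) (by simp) (by simp)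
    by_cases hpe : IsWitness G ψ s p e
    · exact cut e hpe (by simp)
    · exact short [a, b, t, d, e, p] t rfl
        (by simp [hab, hbc, hcd, hde, total p e hpt.1 hes
          (not_iff_of_not_iff_of_not_iff cpc ccd cde) hpe, hpt])
        (hnd.sublist (by simp)) (by simp) (by simp)
  refine cut t hpt (hts.imp_right fun h => ?_)
  rw [List.mem_cons, List.mem_cons, List.mem_cons, or_iff_right htb, or_iff_right htc] at h
  exact List.mem_cons.2 h

end ShortWalks

/-! ### Composing circuits -/

namespace Circuit

variable {n : ℕ}

/-- The first `N` gates of an infinite sequence of gates. -/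
def ofSeq (g : (i : ℕ) → Gate n i) (o : ℕ) : Circuit n where
  size := o + 1
  gate i := g i
  output := Fin.last o

/-- Gates read only smaller indices, so values depend on a prefix of the gate list and appended
gates disturb nothing. -/
theorem val_congr {C D : Circuit n} (x : Fin n → Bool) (N : ℕ) (hC : N ≤ C.size) (hD : N ≤ D.size)
    (h : ∀ i (hi : i < N), C.gate ⟨i, hi.trans_le hC⟩ = D.gate ⟨i, hi.trans_le hD⟩) :
    ∀ i (hi : i < N), C.val x ⟨i, hi.trans_le hC⟩ = D.val x ⟨i, hi.trans_le hD⟩ := by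
  intro i
  induction i using Nat.strong_induction_on with
  | _ i ih =>
    intro hi
    rw [val, val, ← h i hi]
    have key (g : Fin i) := ih g g.2 (g.2.trans hi)
    cases C.gate ⟨i, hi.trans_le hC⟩ with
    | input j => rfl
    | not g => simp only [key g]
    | and gs => simp only [key]
    | or gs => simp only [key]

theorem gateDepth_congr {C D : Circuit n} (N : ℕ) (hC : N ≤ C.size) (hD : N ≤ D.size)
    (h : ∀ i (hi : i < N), C.gate ⟨i, hi.trans_le hC⟩ = D.gate ⟨i, hi.trans_le hD⟩) :
    ∀ i (hi : i < N), C.gateDepth ⟨i, hi.trans_le hC⟩ = D.gateDepth ⟨i, hi.trans_le hD⟩ := by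
  intro i
  induction i using Nat.strong_induction_on with
  | _ i ih =>
    intro hi
    rw [gateDepth, gateDepth, ← h i hi]
    have key (g : Fin i) := ih g g.2 (g.2.trans hi)
    cases C.gate ⟨i, hi.trans_le hC⟩ with
    | input j => rfl
    | not g => simp only [key g]
    | and gs => simp only [key]
    | or gs => simp only [key]

theorem eval_ofSeq_congr {g g' : (i : ℕ) → Gate n i} {o : ℕ} (h : ∀ i ≤ o, g' i = g i)
    (x : Fin n → Bool) : (ofSeq g' o).eval x = (ofSeq g o).eval x :=
  val_congr x (o + 1) le_rfl le_rfl (fun i hi => h i (by omega)) o (by omega)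

theorem depth_ofSeq_congr {g g' : (i : ℕ) → Gate n i} {o : ℕ} (h : ∀ i ≤ o, g' i = g i) :
    (ofSeq g' o).depth = (ofSeq g o).depth :=
  gateDepth_congr (o + 1) le_rfl le_rfl (fun i hi => h i (by omega)) o (by omega)

theorem eval_ofSeq (g : (i : ℕ) → Gate n i) (o : ℕ) (x : Fin n → Bool) :
    (ofSeq g o).eval x = match g o with
      | .input j => x j
      | .not p => !(ofSeq g p).eval x
      | .and ps => decide (∀ p ∈ ps, (ofSeq g p).eval x = true)
      | .or ps => decide (∃ p ∈ ps, (ofSeq g p).eval x = true) := by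
  have key (p : Fin o) : (ofSeq g o).val x ⟨p, Nat.lt_succ_of_lt p.2⟩ = (ofSeq g p).eval x :=
    val_congr (C := ofSeq g o) (D := ofSeq g p) x (p + 1) (Nat.succ_le_succ p.2.le) le_rfl
      (fun _ _ => rfl) p (by omega)
  rw [eval, val]
  simp only [← key]
  split <;> rename_i h <;> change g o = _ at h <;> rw [h] <;> rfl

theorem depth_ofSeq (g : (i : ℕ) → Gate n i) (o : ℕ) :
    (ofSeq g o).depth = match g o with
      | .input _ => 0
      | .not p => (ofSeq g p).depth + 1
      | .and ps => ps.sup fun p => (ofSeq g p).depth + 1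
      | .or ps => ps.sup fun p => (ofSeq g p).depth + 1 := by
  have key (p : Fin o) : (ofSeq g o).gateDepth ⟨p, Nat.lt_succ_of_lt p.2⟩ = (ofSeq g p).depth :=
    gateDepth_congr (C := ofSeq g o) (D := ofSeq g p) (p + 1) (Nat.succ_le_succ p.2.le) le_rfl
      (fun _ _ => rfl) p (by omega)
  rw [depth, gateDepth]
  simp only [← key]
  split <;> rename_i h <;> change g o = _ at h <;> rw [h] <;> rfl

/-- `Computes d m F`: every list of gates can be extended by at most `m` gates, the last of which
computes the predicate `F` in depth at most `d`. -/
def Computes (d m : ℕ) (F : (Fin n → Bool) → Prop) : Prop :=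
  ∀ (g : (i : ℕ) → Gate n i) (N : ℕ), ∃ g' : (i : ℕ) → Gate n i, (∀ i < N, g' i = g i) ∧
    ∃ o < N + m, (ofSeq g' o).depth ≤ d ∧ ∀ x, (ofSeq g' o).eval x = true ↔ F x

namespace Computes

variable {d m : ℕ} {F F' : (Fin n → Bool) → Prop}

theorem exists_circuit (h : Computes d m F) :
    ∃ C : Circuit n, C.depth ≤ d ∧ C.size ≤ m ∧ ∀ x, C.eval x = true ↔ F x := by
  obtain ⟨g, -, o, ho, hd, hx⟩ := h (fun _ => .and ∅) 0
  exact ⟨ofSeq g o, hd, show o + 1 ≤ m by omega, hx⟩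

theorem mono {d' m' : ℕ} (h : Computes d m F) (hd : d ≤ d') (hm : m ≤ m') :
    Computes d' m' F := by
  intro g N
  obtain ⟨g', hg, o, ho, hd', hx⟩ := h g N
  exact ⟨g', hg, o, by omega, hd'.trans hd, hx⟩

theorem congr (h : Computes d m F) (hF : ∀ x, F x ↔ F' x) : Computes d m F' := by
  rwa [show F' = F from funext fun x => propext (hF x).symm]

theorem input (i : Fin n) : Computes 0 1 fun x => x i = true := by
  intro g N
  refine ⟨Function.update g N (.input i), fun j hj => Function.update_of_ne hj.ne _ _, N,
    by omega, ?_, fun x => ?_⟩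
  · rw [depth_ofSeq, Function.update_self]
  · rw [eval_ofSeq, Function.update_self]

theorem not (h : Computes d m F) : Computes (d + 1) (m + 1) fun x => ¬ F x := by
  intro g N
  obtain ⟨g', hg, o, ho, hd, hx⟩ := h g N
  -- The new gate goes just past the reserved block of `m` indices. Unused gates inside the block
  -- are harmless, as only the size bound counts them.
  have hagree : ∀ i ≤ o, Function.update g' (N + m) (.not ⟨o, ho⟩) i = g' i :=
    fun i hi => Function.update_of_ne (by omega) _ _
  refine ⟨Function.update g' (N + m) (.not ⟨o, ho⟩),
    fun i hi => (Function.update_of_ne (by omega) _ _).trans (hg i hi), N + m,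
    by omega, ?_, fun x => ?_⟩
  · rw [depth_ofSeq, Function.update_self]
    exact Nat.succ_le_succ ((depth_ofSeq_congr hagree).trans_le hd)
  · rw [eval_ofSeq, Function.update_self]
    simp [eval_ofSeq_congr hagree, ← hx x]

/-- The subcircuits are laid out in consecutive blocks, each preserving the gates before it. -/
theorem exists_family {r : ℕ} {F : Fin r → (Fin n → Bool) → Prop} (h : ∀ j, Computes d m (F j))
    (g : (i : ℕ) → Gate n i) (N : ℕ) :
    ∃ g' : (i : ℕ) → Gate n i, (∀ i < N, g' i = g i) ∧ ∃ o : Fin r → Fin (N + r * m),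
      ∀ j, (ofSeq g' (o j)).depth ≤ d ∧ ∀ x, (ofSeq g' (o j)).eval x = true ↔ F j x := by
  induction r with
  | zero => exact ⟨g, fun _ _ => rfl, Fin.elim0, fun j => j.elim0⟩
  | succ r ih =>
    obtain ⟨g₁, hg₁, o, ho⟩ := ih fun j => h j.castSucc
    obtain ⟨g', hg', q, hq, hqd⟩ := h (Fin.last r) g₁ (N + r * m)
    have hle : N + r * m ≤ N + (r + 1) * m := by
      rw [Nat.succ_mul]
      omega
    refine ⟨g', fun i hi => (hg' i (by omega)).trans (hg₁ i hi),
      Fin.lastCases ⟨q, by rw [Nat.succ_mul]; omega⟩ fun j => (o j).castLE hle, fun j => ?_⟩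
    induction j using Fin.lastCases with
    | last => simpa using hqd
    | cast j =>
      have hagree : ∀ i ≤ (o j : ℕ), g' i = g₁ i := fun i hi => hg' i (by have := (o j).2; omega)
      simp only [Fin.lastCases_castSucc, Fin.val_castLE]
      rw [depth_ofSeq_congr hagree]
      exact ⟨(ho j).1, fun x => by rw [eval_ofSeq_congr hagree]; exact (ho j).2 x⟩

theorem forall_fin {r : ℕ} {F : Fin r → (Fin n → Bool) → Prop} (h : ∀ j, Computes d m (F j)) :
    Computes (d + 1) (r * m + 1) fun x => ∀ j, F j x := by
  intro g N
  obtain ⟨g', hg, o, ho⟩ := exists_family h g N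
  have hagree : ∀ p : Fin (N + r * m), ∀ i ≤ (p : ℕ),
      Function.update g' (N + r * m) (.and (Finset.univ.image o)) i = g' i :=
    fun p i hi => Function.update_of_ne (by have := p.2; omega) _ _
  refine ⟨Function.update g' (N + r * m) (.and (Finset.univ.image o)),
    fun i hi => (Function.update_of_ne (by omega) _ _).trans (hg i hi), N + r * m,
    by omega, ?_, fun x => ?_⟩
  · rw [depth_ofSeq, Function.update_self]
    refine Finset.sup_le fun q hq => ?_
    obtain ⟨j, -, rfl⟩ := Finset.mem_image.1 hq
    exact Nat.succ_le_succ ((depth_ofSeq_congr (hagree _)).trans_le (ho j).1)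
  · rw [eval_ofSeq, Function.update_self]
    simp only [decide_eq_true_eq, Finset.mem_image, Finset.mem_univ, true_and,
      forall_exists_index, forall_apply_eq_imp_iff, eval_ofSeq_congr (hagree _), (ho _).2]

theorem forall_fintype {ι : Type*} [Fintype ι] {F : ι → (Fin n → Bool) → Prop}
    (h : ∀ j, Computes d m (F j)) :
    Computes (d + 1) (Fintype.card ι * m + 1) fun x => ∀ j, F j x :=
  (forall_fin fun j => h ((Fintype.equivFin ι).symm j)).congr fun x =>
    (Fintype.equivFin ι).symm.forall_congr_right (q := fun j => F j x)

end Computes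

end Circuit

/-! ### Hashing and threshold circuits -/

/-- The multiplicative hash functions modulo a prime. -/
def multHash (p M a x : ℕ) : ℕ := a * x % p % M

/-- Few multipliers lead to a collision of two given numbers. -/
theorem card_multHash_collision_le {p M x y : ℕ} [hp : Fact p.Prime] (hx : x < p) (hy : y < p)
    (hxy : x < y) :
    ((Finset.Ico 1 p).filter fun a => multHash p M a x = multHash p M a y).card ≤
      2 * ((p - 1) / M) := by
  have hyx : (y : ZMod p) - x ≠ 0 := by
    rw [sub_ne_zero, Ne, ZMod.natCast_eq_natCast_iff', Nat.mod_eq_of_lt hx, Nat.mod_eq_of_lt hy]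
    exact hxy.ne'
  have hne : ∀ a ∈ Finset.Ico 1 p, a * x % p ≠ a * y % p := by
    intro a ha h
    rw [← ZMod.natCast_eq_natCast_iff'] at h
    push_cast at h
    have ha0 : (a : ZMod p) ≠ 0 := by
      rw [Ne, ZMod.natCast_eq_zero_iff]
      exact Nat.not_dvd_of_pos_of_lt (Finset.mem_Ico.1 ha).1 (Finset.mem_Ico.1 ha).2
    exact hyx (sub_eq_zero.2 (mul_left_cancel₀ ha0 h).symm)
  -- Reduction modulo 0 is the identity, so `M = 0` gives no collisions.
  rcases Nat.eq_zero_or_pos M with rfl | hM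
  · refine (Finset.card_eq_zero.2 (Finset.filter_eq_empty_iff.2 fun a ha h => ?_)).le.trans
      (Nat.zero_le _)
    rw [multHash, multHash, Nat.mod_zero, Nat.mod_zero] at h
    exact hne a ha h
  have hQ : (0 : ℤ) ≤ ((p - 1) / M : ℕ) := Int.natCast_nonneg _
  have hcard : ((Finset.Icc (-((p - 1) / M : ℕ) : ℤ) ((p - 1) / M : ℕ)).erase 0).card =
      2 * ((p - 1) / M) := by
    rw [Finset.card_erase_of_mem (Finset.mem_Icc.2 ⟨neg_nonpos.2 hQ, hQ⟩), Int.card_Icc]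
    omega
  rw [← hcard]
  have hdvd : ∀ a ∈ (Finset.Ico 1 p).filter fun a => multHash p M a x = multHash p M a y,
      (M : ℤ) * (((a * y % p : ℕ) - (a * x % p : ℕ) : ℤ) / M) =
        (a * y % p : ℕ) - (a * x % p : ℕ) := fun a ha =>
    Int.mul_ediv_cancel' ((Nat.modEq_iff_dvd).1 (Finset.mem_filter.1 ha).2)
  -- A collision makes the difference of the residues a nonzero multiple `t * M` with `|t| ≤ (p - 1)
  -- / M`. The multiplier is recovered from `t`, because the difference is `a * (y - x)` modulo `p`
  -- and `y - x` is invertible.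
  refine Finset.card_le_card_of_injOn
    (fun a => (((a * y % p : ℕ) - (a * x % p : ℕ) : ℤ) / M)) (fun a ha => ?_) ?_
  · have h := hdvd a ha
    have hlt : a * y % p < p := Nat.mod_lt _ hp.out.pos
    have hlt' : a * x % p < p := Nat.mod_lt _ hp.out.pos
    have hne' := hne a (Finset.mem_filter.1 ha).1
    simp only [Finset.coe_erase, Finset.coe_Icc, Set.mem_sdiff, Set.mem_Icc, Set.mem_singleton_iff]
    set t : ℤ := ((a * y % p : ℕ) - (a * x % p : ℕ) : ℤ) / M
    have ht : t.natAbs ≤ (p - 1) / M := by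
      rw [Nat.le_div_iff_mul_le hM, mul_comm]
      have := congrArg Int.natAbs h
      rw [Int.natAbs_mul, Int.natAbs_natCast] at this
      omega
    refine ⟨by omega, fun h0 => hne' ?_⟩
    rw [h0, mul_zero] at h
    omega
  · intro a ha b hb hab
    have h : ((a * y % p : ℕ) - (a * x % p : ℕ) : ℤ) = (b * y % p : ℕ) - (b * x % p : ℕ) := by
      rw [← hdvd a ha, ← hdvd b hb]
      exact congrArg _ hab
    have h' := congrArg (Int.cast : ℤ → ZMod p) h
    push_cast [ZMod.natCast_mod] at h'
    rw [← mul_sub, ← mul_sub] at h'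
    have h'' := mul_right_cancel₀ hyx h'
    rw [ZMod.natCast_eq_natCast_iff'] at h''
    rwa [Nat.mod_eq_of_lt (Finset.mem_Ico.1 (Finset.mem_filter.1 ha).1).2,
      Nat.mod_eq_of_lt (Finset.mem_Ico.1 (Finset.mem_filter.1 hb).1).2] at h''

/-- Every small set is hashed injectively by one of the multiplicative hash functions. -/
theorem exists_multHash_injOn {p m : ℕ} (hp : p.Prime) (X : Finset ℕ) (hX : X.card ≤ m)
    (hXp : ∀ x ∈ X, x < p) : ∃ a < p, Set.InjOn (multHash p (m ^ 2) a) X := by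
  have := Fact.mk hp
  by_contra! hcon
  have hsub : Finset.Ico 1 p ⊆ (X.powersetCard 2).biUnion fun e =>
      (Finset.Ico 1 p).filter fun a =>
        ∃ x ∈ e, ∃ y ∈ e, x < y ∧ multHash p (m ^ 2) a x = multHash p (m ^ 2) a y := by
    intro a ha
    have h := hcon a (Finset.mem_Ico.1 ha).2
    simp only [Set.InjOn, not_forall] at h
    obtain ⟨x, hx, y, hy, hh, hne⟩ := h
    rw [Finset.mem_biUnion]
    refine ⟨{x, y}, ?_, Finset.mem_filter.2 ⟨ha, ?_⟩⟩
    · rw [Finset.mem_powersetCard]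
      refine ⟨?_, Finset.card_pair hne⟩
      intro z hz
      rcases Finset.mem_insert.1 hz with rfl | hz
      · exact hx
      · rwa [Finset.mem_singleton.1 hz]
    · rcases lt_or_gt_of_ne hne with hlt | hlt
      · exact ⟨x, by simp, y, by simp, hlt, hh⟩
      · exact ⟨y, by simp, x, by simp, hlt, hh.symm⟩
  have hcard : ∀ e ∈ X.powersetCard 2, ((Finset.Ico 1 p).filter fun a =>
      ∃ x ∈ e, ∃ y ∈ e, x < y ∧ multHash p (m ^ 2) a x = multHash p (m ^ 2) a y).card ≤
        2 * ((p - 1) / m ^ 2) := by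
    intro e he
    rw [Finset.mem_powersetCard] at he
    obtain ⟨x, y, hne, rfl⟩ := Finset.card_eq_two.1 he.2
    wlog hlt : x < y generalizing x y
    · rw [Finset.pair_comm] at he ⊢
      exact this y x hne.symm he (by omega)
    refine le_trans (Finset.card_le_card fun a ha => ?_)
      (card_multHash_collision_le (hXp x (he.1 (by simp))) (hXp y (he.1 (by simp))) hlt)
    simp only [Finset.mem_filter, Finset.mem_insert, Finset.mem_singleton] at ha ⊢
    obtain ⟨ha, x', rfl | rfl, y', rfl | rfl, hlt', h⟩ := ha
    · omega
    · exact ⟨ha, h⟩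
    · omega
    · omega
  -- Union bound: at most `m(m - 1)/2` pairs with at most `2⌊(p - 1)/m²⌋` bad multipliers each
  -- cannot exhaust the `p - 1` multipliers.
  have hle := (Finset.card_le_card hsub).trans (Finset.card_biUnion_le_card_mul _ _ _ hcard)
  rw [Nat.card_Ico, Finset.card_powersetCard, Nat.choose_two_right] at hle
  have hp1 : 0 < p - 1 := Nat.sub_pos_of_lt hp.one_lt
  have h1 : X.card * (X.card - 1) / 2 * (2 * ((p - 1) / m ^ 2)) ≤
      X.card * (X.card - 1) * ((p - 1) / m ^ 2) := by
    rw [← mul_assoc]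
    exact Nat.mul_le_mul_right _ (Nat.div_mul_le_self _ _)
  have h2 : X.card * (X.card - 1) * ((p - 1) / m ^ 2) ≤ m * (m - 1) * ((p - 1) / m ^ 2) := by
    gcongr
  rcases Nat.eq_zero_or_pos m with rfl | hm
  · simp at h2
    omega
  have h3 : m ^ 2 * ((p - 1) / m ^ 2) ≤ p - 1 := Nat.mul_div_le _ _
  have h4 : m * (m - 1) + m = m ^ 2 := by
    obtain ⟨m, rfl⟩ := Nat.exists_eq_succ_of_ne_zero hm.ne'
    simp
    ring
  generalize (p - 1) / m ^ 2 = q at *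
  rcases Nat.eq_zero_or_pos q with rfl | h0
  · simp at hle
    omega
  · have := Nat.mul_pos hm h0
    rw [← h4, add_mul] at h3
    omega

/-- A set of at least `k + 1` vertices contains `k + 1` vertices with different hash values. -/
theorem ncard_le_iff_forall_multHash {n k p : ℕ} (hp : p.Prime) (hnp : n ≤ p) (P : Fin n → Prop) :
    {v | P v}.ncard ≤ k ↔ ∀ ac : Fin p × (Fin (k + 1) ↪ Fin ((k + 1) ^ 2)), ¬ ∀ j,
      ¬ ∀ v : {v : Fin n // multHash p ((k + 1) ^ 2) ac.1 v = ac.2 j}, ¬ P v := by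
  classical
  rw [← not_iff_not]
  push Not
  constructor
  · intro h
    rw [Set.ncard_eq_toFinset_card'] at h
    obtain ⟨X, hX, hcard⟩ := Finset.exists_subset_card_eq (Nat.succ_le_of_lt h)
    obtain ⟨a, ha, hinj⟩ := exists_multHash_injOn (m := k + 1) hp (X.map Fin.valEmbedding)
      (by simp [hcard]) (by simpa using fun v _ => v.2.trans_le hnp)
    let e := (X.equivFinOfCardEq hcard).symm
    have hmem : ∀ j, (((e j : X) : Fin n) : ℕ) ∈ (X.map Fin.valEmbedding : Set ℕ) := fun j =>
      Finset.mem_coe.2 (Finset.mem_map.2 ⟨e j, (e j).2, rfl⟩)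
    refine ⟨⟨⟨a, ha⟩, ⟨fun j => ⟨multHash p ((k + 1) ^ 2) a (e j), Nat.mod_lt _ (by positivity)⟩,
      fun i j hij => ?_⟩⟩, fun j => ⟨⟨e j, rfl⟩, by simpa using hX (e j).2⟩⟩
    exact e.injective (Subtype.ext (Fin.ext (hinj (hmem i) (hmem j) (Fin.mk.inj_iff.1 hij))))
  · rintro ⟨⟨a, c⟩, h⟩
    choose v hv using h
    have hinj : Function.Injective fun j => (v j : Fin n) := by
      intro i j hij
      refine c.injective (Fin.ext ?_)
      rw [← (v i).2, ← (v j).2]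
      exact congrArg (fun w : Fin n => multHash p ((k + 1) ^ 2) a w) hij
    have hle : (Set.range fun j => (v j : Fin n)).ncard ≤ {v | P v}.ncard :=
      Set.ncard_le_ncard (Set.range_subset_iff.2 hv) (Set.toFinite _)
    rw [← Set.image_univ, Set.ncard_image_of_injective _ hinj, Set.ncard_univ, Nat.card_fin] at hle
    exact hle

namespace Circuit.Computes

variable {n d m : ℕ} {F F' : (Fin n → Bool) → Prop}

theorem const (p : Prop) : Computes 2 2 fun _ : Fin n → Bool => p := by
  have h : Computes 1 1 fun _ : Fin n → Bool => True :=
    (forall_fin (d := 0) (m := 0) (r := 0) (F := fun _ _ => True) nofun).congr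
      (by simp) |>.mono le_rfl (by simp)
  by_cases hp : p
  · exact (h.congr (by simp [hp])).mono (by simp) (by simp)
  · exact h.not.congr (by simp [hp])

theorem and {d' m' : ℕ} (h : Computes d m F) (h' : Computes d' m' F') :
    Computes (d + d' + 1) (2 * (m + m') + 1) fun x => F x ∧ F' x :=
  (forall_fin (F := ![F, F']) (d := d + d') (m := m + m') fun j => by
    fin_cases j
    · exact h.mono (by simp) (by simp)
    · exact h'.mono (by simp) (by simp)).congr fun x => by simp [Fin.forall_fin_two]

theorem exists_fintype {ι : Type*} [Fintype ι] {F : ι → (Fin n → Bool) → Prop}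
    (h : ∀ j, Computes d m (F j)) :
    Computes (d + 3) (Fintype.card ι * (m + 1) + 2) fun x => ∃ j, F j x :=
  (forall_fintype fun j => (h j).not).not.congr fun x => by simp

/-- The circuits for counting up to a threshold have constant depth and a size whose dependence on
the threshold is a factor. -/
theorem ncard_le {r : ℕ} {F : Fin r → (Fin n → Bool) → Prop} (h : ∀ v, Computes d m (F v)) (k : ℕ) :
    Computes (d + 6) (13 * ((k + 1) ^ 2) ^ (k + 1) * (k + 1) * (r * r * (m + 1)) + 2)
      fun x => {v | F v x}.ncard ≤ k := by
  rcases Nat.eq_zero_or_pos r with rfl | hr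
  · refine ((const True).congr fun x => ?_).mono (by omega) (by omega)
    simp [Set.eq_empty_of_isEmpty]
  -- Bertrand's postulate keeps the number of multipliers linear in `r`.
  obtain ⟨p, hp, hrp, hpr⟩ := Nat.exists_prime_lt_and_le_two_mul r hr.ne'
  have h₁ : ∀ (ac : Fin p × (Fin (k + 1) ↪ Fin ((k + 1) ^ 2))) (j : Fin (k + 1)),
      Computes (d + 2) (r * (m + 1) + 1) fun x =>
        ∀ v : {v : Fin r // multHash p ((k + 1) ^ 2) ac.1 v = ac.2 j}, ¬ F v x := fun ac j =>
    (forall_fintype fun v : {v : Fin r // multHash p ((k + 1) ^ 2) ac.1 v = ac.2 j} =>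
      (h v).not).mono le_rfl (by
        gcongr
        exact (Fintype.card_subtype_le _).trans (Fintype.card_fin r).le)
  refine ((forall_fintype fun ac => (forall_fintype fun j => (h₁ ac j).not).not).congr fun x =>
    (ncard_le_iff_forall_multHash hp hrp.le fun v => F v x).symm).mono le_rfl ?_
  rw [Fintype.card_prod, Fintype.card_fin, Fintype.card_fin, Fintype.card_embedding_eq,
    Fintype.card_fin, Fintype.card_fin]
  have hdesc := Nat.descFactorial_le_pow ((k + 1) ^ 2) (k + 1)
  calc p * ((k + 1) ^ 2).descFactorial (k + 1) * ((k + 1) * (r * (m + 1) + 1 + 1) + 1 + 1) + 1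
      ≤ 2 * r * ((k + 1) ^ 2) ^ (k + 1) * ((k + 1) * (r * (m + 1) + 1 + 1) + 1 + 1) + 1 := by
        gcongr
    _ ≤ 2 * r * ((k + 1) ^ 2) ^ (k + 1) * (5 * ((k + 1) * (r * (m + 1)))) + 1 := by
        have h2 : 1 ≤ r * (m + 1) := Nat.mul_pos hr (by omega)
        gcongr
        generalize r * (m + 1) = q at *
        nlinarith
    _ ≤ 13 * ((k + 1) ^ 2) ^ (k + 1) * (k + 1) * (r * r * (m + 1)) + 2 := by
        generalize ((k + 1) ^ 2) ^ (k + 1) = q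
        have : 2 * r * q * (5 * ((k + 1) * (r * (m + 1)))) =
          10 * (q * (k + 1) * (r * r * (m + 1))) := by ring
        rw [this, mul_assoc 13, mul_assoc 13]
        omega

end Circuit.Computes

/-! ### Circuits on adjacency matrices -/

open Circuit FirstOrder

/-- The graph with a given adjacency matrix; the diagonal is ignored and the matrix is
symmetrized. -/
def bitGraph {n : ℕ} (x : Fin (n * n) → Bool) : SimpleGraph (Fin n) :=
  SimpleGraph.fromRel fun i j => x (finProdFinEquiv (i, j)) = true

theorem bitGraph_eq_of_encodeGraph_eq {n : ℕ} {G : SimpleGraph (Fin n)} {x : Fin (n * n) → Bool}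
    (h : encodeGraph G = List.ofFn x) : bitGraph x = G := by
  classical
  have hx : ∀ i j, x (finProdFinEquiv (i, j)) = true ↔ G.Adj i j := by
    intro i j
    have := congrFun (List.ofFn_injective h) (finProdFinEquiv (i, j))
    have hinv := finProdFinEquiv.symm_apply_apply (i, j)
    rw [finProdFinEquiv_symm_apply, Prod.mk.injEq] at hinv
    rw [← this, hinv.1, hinv.2, decide_eq_true_iff]
  ext i j
  rw [bitGraph, SimpleGraph.fromRel_adj, hx, hx, G.adj_comm j i, or_self]
  exact ⟨And.right, fun h => ⟨h.ne, h⟩⟩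

/-- A family of predicates of adjacency matrices is decided by constant depth circuits of
polynomial size. -/
def PolyComputes {ι : ℕ → Type*} (F : ∀ n, ι n → (Fin (n * n) → Bool) → Prop) : Prop :=
  ∃ d a e, ∀ n i, Computes d (a * (n * n + 1) ^ e) (F n i)

namespace PolyComputes

variable {ι κ : ℕ → Type*} {F F' : ∀ n, ι n → (Fin (n * n) → Bool) → Prop}

theorem congr (h : PolyComputes F) (hF : ∀ n i x, F n i x ↔ F' n i x) : PolyComputes F' := by
  obtain ⟨d, a, e, h⟩ := h
  exact ⟨d, a, e, fun n i => (h n i).congr (hF n i)⟩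

theorem comp (h : PolyComputes F) (f : ∀ n, κ n → ι n) :
    PolyComputes fun n i => F n (f n i) := by
  obtain ⟨d, a, e, h⟩ := h
  exact ⟨d, a, e, fun n i => h n (f n i)⟩

theorem const (p : ∀ n, ι n → Prop) : PolyComputes fun n i _ => p n i :=
  ⟨2, 2, 0, fun n i => Computes.const (p n i)⟩

theorem input : PolyComputes fun n (i : Fin (n * n)) x => x i = true :=
  ⟨0, 1, 0, fun _ i => Computes.input i⟩

theorem not (h : PolyComputes F) : PolyComputes fun n i x => ¬ F n i x := by
  obtain ⟨d, a, e, h⟩ := h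
  refine ⟨d + 1, a + 1, e, fun n i => (h n i).not.mono le_rfl ?_⟩
  have := Nat.one_le_pow e (n * n + 1) (by omega)
  rw [add_mul]
  omega

theorem and (h : PolyComputes F) (h' : PolyComputes F') :
    PolyComputes fun n i x => F n i x ∧ F' n i x := by
  obtain ⟨d, a, e, h⟩ := h
  obtain ⟨d', a', e', h'⟩ := h'
  refine ⟨d + d' + 1, 2 * (a + a') + 1, e + e', fun n i => ((h n i).and (h' n i)).mono le_rfl ?_⟩
  have h1 := Nat.one_le_pow (e + e') (n * n + 1) (by omega)
  have h2 : (n * n + 1) ^ e ≤ (n * n + 1) ^ (e + e') := Nat.pow_le_pow_right (by omega) (by omega)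
  have h3 : (n * n + 1) ^ e' ≤ (n * n + 1) ^ (e + e') := Nat.pow_le_pow_right (by omega) (by omega)
  calc 2 * (a * (n * n + 1) ^ e + a' * (n * n + 1) ^ e') + 1
      ≤ 2 * (a * (n * n + 1) ^ (e + e') + a' * (n * n + 1) ^ (e + e')) +
        (n * n + 1) ^ (e + e') := by gcongr
    _ = _ := by ring

theorem imp (h : PolyComputes F) (h' : PolyComputes F') :
    PolyComputes fun n i x => F n i x → F' n i x :=
  (h.and h'.not).not.congr fun n i x => by tauto

theorem or (h : PolyComputes F) (h' : PolyComputes F') :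
    PolyComputes fun n i x => F n i x ∨ F' n i x :=
  (h.not.imp h').congr fun n i x => by tauto

theorem forall_fintype [∀ n, Fintype (κ n)] {F : ∀ n, ι n → κ n → (Fin (n * n) → Bool) → Prop}
    (h : PolyComputes fun n (i : ι n × κ n) => F n i.1 i.2)
    (hκ : ∃ b e, ∀ n, Fintype.card (κ n) ≤ b * (n * n + 1) ^ e) :
    PolyComputes fun n i x => ∀ j, F n i j x := by
  obtain ⟨d, a, e, h⟩ := h
  obtain ⟨b, e', hκ⟩ := hκ
  refine ⟨d + 1, b * a + 1, e' + e, fun n i =>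
    (Computes.forall_fintype fun j => h n (i, j)).mono le_rfl ?_⟩
  have h1 := Nat.one_le_pow (e' + e) (n * n + 1) (by omega)
  calc Fintype.card (κ n) * (a * (n * n + 1) ^ e) + 1
      ≤ b * (n * n + 1) ^ e' * (a * (n * n + 1) ^ e) + (n * n + 1) ^ (e' + e) := by
        gcongr
        exact hκ n
    _ = _ := by ring

theorem exists_fintype [∀ n, Fintype (κ n)] {F : ∀ n, ι n → κ n → (Fin (n * n) → Bool) → Prop}
    (h : PolyComputes fun n (i : ι n × κ n) => F n i.1 i.2)
    (hκ : ∃ b e, ∀ n, Fintype.card (κ n) ≤ b * (n * n + 1) ^ e) :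
    PolyComputes fun n i x => ∃ j, F n i j x :=
  (forall_fintype (F := fun n i j x => ¬ F n i j x) h.not hκ).not.congr fun n i x => by simp

theorem exists_card_fin_le : ∃ b e, ∀ n, Fintype.card (Fin n) ≤ b * (n * n + 1) ^ e :=
  ⟨1, 1, fun n => by
    have := Nat.le_mul_self n
    simp
    omega⟩

theorem bitGraph_adj :
    PolyComputes fun n (p : Fin n × Fin n) x => (bitGraph x).Adj p.1 p.2 :=
  ((const fun n (p : Fin n × Fin n) => p.1 ≠ p.2).and
    ((input.comp fun n (p : Fin n × Fin n) => finProdFinEquiv (p.1, p.2)).or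
      (input.comp fun n (p : Fin n × Fin n) => finProdFinEquiv (p.2, p.1)))).congr fun n p x => by
        rw [bitGraph, SimpleGraph.fromRel_adj]

theorem graphRealize {r : ℕ} {φ : Language.graph.BoundedFormula Empty r} (hφ : φ.IsQF) :
    PolyComputes fun n (xs : Fin r → Fin n) x => GraphRealize (bitGraph x) φ xs := by
  refine graphQF_induction (P := fun φ => PolyComputes fun n (xs : Fin r → Fin n) x =>
    GraphRealize (bitGraph x) φ xs) ?_ (fun i j => ?_) (fun i j => ?_) (fun φ χ h h' => ?_) hφ
  · exact (const fun _ _ => False).congr fun n xs x => Iff.rfl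
  · exact (const fun n (xs : Fin r → Fin n) => xs i = xs j).congr fun n xs x => Iff.rfl
  · exact bitGraph_adj.comp fun n (xs : Fin r → Fin n) => (xs i, xs j)
  · exact h.imp h'

/-- `bitGraph` repairs an asymmetric matrix or a nonzero diagonal, so a word is a valid encoding
exactly if re-encoding returns it. -/
theorem encodeGraph_bitGraph_eq :
    PolyComputes fun n (_ : Unit) x => encodeGraph (bitGraph x) = List.ofFn (n := n * n) x := by
  classical
  have hadj := bitGraph_adj.comp fun n (i : Unit × Fin (n * n)) => (i.2.divNat, i.2.modNat)
  have hin := input.comp fun n (i : Unit × Fin (n * n)) => i.2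
  refine (forall_fintype (κ := fun n => Fin (n * n)) (F := fun n _ i x =>
    ((bitGraph x).Adj i.divNat i.modNat → x i = true) ∧
      (x i = true → (bitGraph x).Adj i.divNat i.modNat))
    ((hadj.imp hin).and (hin.imp hadj)) ⟨1, 1, fun n => by simp⟩).congr fun n i x => ?_
  rw [encodeGraph, List.ofFn_injective.eq_iff, funext_iff]
  refine forall_congr' fun i => ?_
  rw [← iff_iff_implies_and_implies]
  by_cases h : (bitGraph x).Adj i.divNat i.modNat <;> simp [h]

variable {ψ : Language.graph.BoundedFormula Empty 3}

theorem isStableWalk (hψ : ψ.IsQF) :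
    PolyComputes fun n (p : (Fin n × Fin n) × {w : List (Fin n) // w.length ≤ 10}) x =>
      IsStableWalk (bitGraph x) ψ p.1.1 p.1.2 p.2.1 := by
  -- The default value of `getD` is irrelevant, because the guard keeps both indices in range.
  have hwit := (const fun n (p : ((Fin n × Fin n) × {w : List (Fin n) // w.length ≤ 10}) × Fin 10) =>
    (p.2 : ℕ) + 1 < p.1.2.1.length).imp
    ((const fun n (p : ((Fin n × Fin n) × {w : List (Fin n) // w.length ≤ 10}) × Fin 10) =>
      p.1.2.1.getD p.2 p.1.1.1 ≠ p.1.1.1).and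
    ((graphRealize hψ).comp fun n
      (p : ((Fin n × Fin n) × {w : List (Fin n) // w.length ≤ 10}) × Fin 10) =>
        ![p.1.1.1, p.1.2.1.getD p.2 p.1.1.1, p.1.2.1.getD (p.2 + 1) p.1.1.1]))
  have hchain := forall_fintype (κ := fun _ => Fin 10)
    (F := fun n (p : (Fin n × Fin n) × {w : List (Fin n) // w.length ≤ 10}) i x => (i : ℕ) + 1 < p.2.1.length → p.2.1.getD i p.1.1 ≠ p.1.1 ∧
      GraphRealize (bitGraph x) ψ ![p.1.1, p.2.1.getD i p.1.1, p.2.1.getD (i + 1) p.1.1])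
    hwit ⟨10, 0, fun n => by simp⟩
  -- The list is part of the index rather than of the input, so every condition except the witness
  -- relation is a constant.
  refine ((const fun n (p : (Fin n × Fin n) × {w : List (Fin n) // w.length ≤ 10}) =>
    p.2.1.head? = some p.1.2).and (hchain.and (const fun n
      (p : (Fin n × Fin n) × {w : List (Fin n) // w.length ≤ 10}) => p.2.1.dropLast.Nodup ∧
        ∃ t, p.2.1.getLast? = some t ∧ (t = p.1.1 ∨ t ∈ p.2.1.dropLast)))).congr ?_
  rintro n ⟨⟨s, v⟩, w, hw⟩ x
  refine and_congr_right fun _ => and_congr_left fun _ => ?_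
  rw [List.isChain_iff_getElem]
  constructor
  · intro h i hi
    have hi' : i + 1 < w.length := hi
    have := h ⟨i, by omega⟩ hi
    rwa [List.getD_eq_getElem _ _ (Nat.lt_of_succ_lt hi'), List.getD_eq_getElem _ _ hi'] at this
  · intro h i hi
    have hi' : (i : ℕ) + 1 < w.length := hi
    have := h i hi
    rwa [List.getD_eq_getElem _ _ (Nat.lt_of_succ_lt hi'), List.getD_eq_getElem _ _ hi']

/-- The length bound is used here: it leaves polynomially many candidate walks for the disjunction.
-/
theorem mem_keptVertices (hψ : ψ.IsQF) :
    PolyComputes fun n (p : Fin n × Fin n) x => p.2 ∈ keptVertices (bitGraph x) ψ p.1 := by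
  have := (isStableWalk hψ).comp
    fun n (q : (Fin n × Fin n) × (Σ l : Fin 11, (Fin l → Fin n))) =>
      (q.1, (⟨List.ofFn q.2.2, by rw [List.length_ofFn]; omega⟩ :
        {w : List (Fin n) // w.length ≤ 10}))
  refine ((const fun n (p : Fin n × Fin n) => p.2 = p.1).or
    (exists_fintype (F := fun n p (q : Σ l : Fin 11, (Fin l → Fin n)) x =>
      IsStableWalk (bitGraph x) ψ p.1 p.2 (List.ofFn q.2)) this ⟨11, 10, fun n => ?_⟩)).congr fun n p x => or_congr_right ?_
  · rw [Fintype.card_sigma]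
    refine (Finset.sum_le_card_nsmul _ _ ((n * n + 1) ^ 10) fun l _ => ?_).trans (by simp)
    rw [Fintype.card_fun, Fintype.card_fin, Fintype.card_fin]
    have := Nat.le_mul_self n
    exact (Nat.pow_le_pow_left (by omega) _).trans
      (Nat.pow_le_pow_right (by omega) (by omega))
  · constructor
    · rintro ⟨q, hq⟩
      exact ⟨_, hq⟩
    · rintro ⟨w, hw⟩
      obtain ⟨w, hw, hlen⟩ := exists_isStableWalk_length_le hψ hw
      exact ⟨⟨⟨w.length, by omega⟩, w.get⟩, by rwa [List.ofFn_get]⟩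

theorem exists_witness_mem_keptVertices (hψ : ψ.IsQF) :
    PolyComputes fun n (s : Fin n) x =>
      ∃ y, y ∈ keptVertices (bitGraph x) ψ s ∧ GraphRealize (bitGraph x) ψ ![s, s, y] :=
  exists_fintype (F := fun _ s y x =>
    y ∈ keptVertices (bitGraph x) ψ s ∧ GraphRealize (bitGraph x) ψ ![s, s, y])
    ((mem_keptVertices hψ).and
      ((graphRealize hψ).comp fun n (p : Fin n × Fin n) => ![p.1, p.1, p.2])) exists_card_fin_le

end PolyComputes

/-! ### Assembling the circuit family. -/

theorem ofFn_mem_vdBasic_iff {ψ : Language.graph.BoundedFormula Empty 3} (hψ : ψ.IsQF) {n : ℕ}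
    (hn : 0 < n) (k : ℕ) (x : Fin (n * n) → Bool) :
    (List.ofFn x, k) ∈ vdBasic ψ.ex.all.ex ↔ encodeGraph (bitGraph x) = List.ofFn x ∧
      ∃ s, (∃ y, y ∈ keptVertices (bitGraph x) ψ s ∧ GraphRealize (bitGraph x) ψ ![s, s, y]) ∧
        {v | v ∉ keptVertices (bitGraph x) ψ s}.ncard ≤ k := by
  have key : ∀ G : SimpleGraph (Fin n),
      (∃ S : Finset (Fin n), S.card ≤ k ∧ GraphRealize (deleteVertices G S) ψ.ex.all.ex ![]) ↔
        ∃ s, (∃ y, y ∈ keptVertices G ψ s ∧ GraphRealize G ψ ![s, s, y]) ∧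
          {v | v ∉ keptVertices G ψ s}.ncard ≤ k := by
    intro G
    simp only [graphRealize_eae_iff]
    constructor
    · rintro ⟨S, hk, s, hS⟩
      exact ⟨s, (exists_isSolution_card_le_iff hψ k).1 ⟨S, hk, hS⟩⟩
    · rintro ⟨s, hs⟩
      obtain ⟨S, hk, hS⟩ := (exists_isSolution_card_le_iff hψ k).2 hs
      exact ⟨S, hk, s, hS⟩
  rw [← key]
  constructor
  · rintro ⟨n', G, -, hG, hS⟩
    obtain rfl : n = n' := by
      have := congrArg List.length hG
      simp only [encodeGraph, List.length_ofFn] at this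
      exact Nat.mul_self_inj.1 this
    rw [bitGraph_eq_of_encodeGraph_eq hG.symm]
    exact ⟨hG.symm, hS⟩
  · rintro ⟨hx, hS⟩
    exact ⟨n, bitGraph x, hn, hx.symm, hS⟩

theorem computable_threshold_factor (a b : ℕ) :
    Computable fun k : ℕ => a * (((k + 1) ^ 2) ^ (k + 1) * (k + 1)) + b := by
  have hpow : Primrec₂ fun m n : ℕ => m ^ n := Primrec₂.unpaired'.1 Nat.Primrec.pow
  have hsucc : Primrec fun k : ℕ => k + 1 := Primrec.succ
  exact (Primrec.nat_add.comp (Primrec.nat_mul.comp (Primrec.const a) (Primrec.nat_mul.comp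
    (hpow.comp (hpow.comp hsucc (Primrec.const 2)) hsucc) hsucc)) (Primrec.const b)).to_comp

theorem vdBasic_mem_paraAC0 {ψ : Language.graph.BoundedFormula Empty 3} (hψ : ψ.IsQF) :
    vdBasic ψ.ex.all.ex ∈ ParaAC0 := by
  obtain ⟨d₁, a₁, e₁, h₁⟩ := PolyComputes.encodeGraph_bitGraph_eq
  obtain ⟨d₂, a₂, e₂, h₂⟩ := PolyComputes.exists_witness_mem_keptVertices hψ
  obtain ⟨d₃, a₃, e₃, h₃⟩ := (PolyComputes.mem_keptVertices hψ).not
  -- The final `+ 2` in the depth accommodates the constant circuit for lengths that encode no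
  -- graph.
  set d := d₁ + (d₂ + (d₃ + 6) + 1 + 3) + 1 + 2
  set c := e₁ + e₂ + e₃ + 3
  obtain ⟨a, b, hab⟩ : ∃ a b, ∀ N k, ∃ C : Circuit N, C.depth ≤ d ∧
      C.size ≤ (a * (((k + 1) ^ 2) ^ (k + 1) * (k + 1)) + b) * (N + 1) ^ c ∧
        ∀ x, C.eval x = true ↔ (List.ofFn x, k) ∈ vdBasic ψ.ex.all.ex := by
    -- The two nested conjunctions each double the sizes, which turns the 13 of the threshold
    -- circuit into 52.
    refine ⟨52 * (a₃ + 1), 2 * a₁ + 4 * a₂ + 20, fun N k => Computes.exists_circuit ?_⟩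
    -- A length that is not a positive square encodes no nonempty graph, so the constant false is
    -- correct there.
    by_cases hN : ∃ n, 0 < n ∧ N = n * n
    · obtain ⟨n, hn, rfl⟩ := hN
      refine (((h₁ n ()).and (Computes.exists_fintype fun s => (h₂ n s).and
        (Computes.ncard_le (fun v => h₃ n (s, v)) k))).congr fun x =>
          (ofFn_mem_vdBasic_iff hψ hn k x).symm).mono (by omega) ?_
      rw [Fintype.card_fin]
      generalize ((k + 1) ^ 2) ^ (k + 1) = q
      have hnn := Nat.le_mul_self n
      have hB : 0 < n * n + 1 := Nat.succ_pos _
      have hE : 1 ≤ (n * n + 1) ^ c := Nat.one_le_pow _ _ hB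
      have hX₀ : n ≤ (n * n + 1) ^ c :=
        (show n ≤ n * n + 1 by omega).trans (Nat.le_self_pow (by omega) _)
      have hX₁ : (n * n + 1) ^ e₁ ≤ (n * n + 1) ^ c := Nat.pow_le_pow_right hB (by omega)
      have hX₂ : n * (n * n + 1) ^ e₂ ≤ (n * n + 1) ^ c :=
        calc n * (n * n + 1) ^ e₂ ≤ (n * n + 1) * (n * n + 1) ^ e₂ := by gcongr; omega
          _ = (n * n + 1) ^ (e₂ + 1) := by ring
          _ ≤ _ := Nat.pow_le_pow_right hB (by omega)
      have hX₃ : n * (n * n * (a₃ * (n * n + 1) ^ e₃ + 1)) ≤ (a₃ + 1) * (n * n + 1) ^ c :=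
        calc n * (n * n * (a₃ * (n * n + 1) ^ e₃ + 1))
            ≤ (n * n + 1) * ((n * n + 1) * (a₃ * (n * n + 1) ^ e₃ + (n * n + 1) ^ e₃)) := by
              gcongr
              · omega
              · omega
              · exact Nat.one_le_pow _ _ hB
          _ = (a₃ + 1) * (n * n + 1) ^ (e₃ + 2) := by ring
          _ ≤ _ := Nat.mul_le_mul_left _ (Nat.pow_le_pow_right hB (by omega))
      generalize (n * n + 1) ^ c = E at *
      calc _ = 2 * a₁ * (n * n + 1) ^ e₁ + 4 * a₂ * (n * (n * n + 1) ^ e₂) +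
            52 * (q * (k + 1)) * (n * (n * n * (a₃ * (n * n + 1) ^ e₃ + 1))) + 12 * n + 5 := by ring
        _ ≤ 2 * a₁ * E + 4 * a₂ * E + 52 * (q * (k + 1)) * ((a₃ + 1) * E) + 12 * E + 5 * E := by
          gcongr
          omega
        _ ≤ 2 * a₁ * E + 4 * a₂ * E + 52 * (q * (k + 1)) * ((a₃ + 1) * E) + 12 * E + 8 * E := by
          gcongr
          omega
        _ = _ := by ring
    · refine ((Computes.const False).congr fun x => (iff_of_false not_false ?_)).mono (by omega) ?_
      · rintro ⟨n, G, hn, hG, -⟩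
        have := congrArg List.length hG
        simp only [encodeGraph, List.length_ofFn] at this
        exact hN ⟨n, hn, this⟩
      · exact (show 2 ≤ _ by omega).trans (Nat.le_mul_of_pos_right _ (by positivity))
  choose C hC using hab
  exact ⟨C, d, c, _, computable_threshold_factor a b, fun N k => ⟨(hC N k).1, (hC N k).2.1⟩,
    fun N k => (hC N k).2.2⟩

theorem mainTheorem5 :
    VDBasic [Quantifier.e, Quantifier.a, Quantifier.e] ⊆ ParaAC0 ∧
    ∀ (ψ : FirstOrder.Language.graph.BoundedFormula Empty 3), ψ.IsQF →
      ∀ (V : Type*) [Finite V] (G : SimpleGraph V) (s v : V), v ≠ s →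
        ((∃ S : Finset V, IsSolution G ψ s S) →
          ((∀ S : Finset V, IsSolution G ψ s S → v ∈ S) ↔
            ¬ ∃ w : List V, IsStableWalk G ψ s v w)) ∧
        ((∃ w : List V, IsStableWalk G ψ s v w) →
          ∃ w : List V, IsStableWalk G ψ s v w ∧ w.length ≤ 10) := by
  refine ⟨?_, fun ψ hψ V _ G s v hvs => ⟨forall_isSolution_mem_iff hψ hvs, ?_⟩⟩
  · rintro Q ⟨φ, hφ, rfl⟩
    obtain _ | _ | hφ := hφ
    obtain _ | hφ := hφ
    obtain _ | _ | hφ := hφ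
    obtain ⟨hφ⟩ := hφ
    exact vdBasic_mem_paraAC0 hφ
  · rintro ⟨w, hw⟩
    exact exists_isStableWalk_length_le hψ hw
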